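/- Let $n\ge 0$ be an integer and $T>0$. For an open set $U\subseteq\mathbb R^n$ (a local coordinate domain), a smooth Ricci flow on $U\times[0,T]$ is a family $g(t)$, $t\in[0,T]$, of Riemannian metrics on $U$ whose components $g_{ij}(t,x)$ are $C^\infty$ on $[0,T]\times U$ and satisfy $\partial_t g_{ij}=-2\,\mathrm{Ric}_{ij}(g(t))$ there (with one-sided time derivatives at $t=0$ and $t=T$). A tensor is called diagonal if all its off-diagonal components in the given coordinates vanish on $U$. (i) A Ricci flow whose metric is diagonal at $t=0$ need not have diagonal Ricci tensor, nor stay diagonal. If $n\ge 3$, there are a nonempty connected open set $U\subseteq\mathbb R^n$ and a smooth Ricci flow $g$ on $U\times[0,T]$ such that $g(0)$ is diagonal on $U$ and, for all indices $i\ne j$, there are $t\in(0,T]$ and $x\in U$ with $\mathrm{Ric}_{ij}(g(t))(x)\ne 0$, and there are $t\in(0,T]$ and $x\in U$ with $g_{ij}(t,x)\neq 0$. (ii) Nonvanishing off-diagonal Ricci entries force nonvanishing off-diagonal metric entries. For every $n$, every open $U\subseteq\mathbb R^n$, every smooth Ricci flow $g$ on $U\times[0,T]$ with $g(0)$ diagonal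 on $U$, all $i\ne j$ and every $x\in U$: if $\mathrm{Ric}_{ij}(g(t))(x)\neq 0$ for some $t\in[0,T]$, then $g_{ij}(s,x)\ne 0$ for some $s\in(0,T]$. -/

import Mathlib

open scoped ContDiff

/-! Riemannian geometry in a local coordinate domain `U ⊆ ℝⁿ`.  A field of bilinear forms is given
by the matrix of its components in the coordinates `x = (x 0, …, x (n-1))`. -/

noncomputable section

namespace LocalGeometry

variable {n : ℕ}

/-- The partial derivative of `f` in the `i`-th coordinate. -/
def pderiv (i : Fin n) (f : (Fin n → ℝ) → ℝ) (x : Fin n → ℝ) : ℝ :=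
  fderiv ℝ f x (Pi.single i 1)

/-- The Christoffel symbol of the second kind, upper index `k`, lower indices `i`, `j`:
`½ ∑ₗ g^{kl} (∂ᵢ g_{jl} + ∂ⱼ g_{il} - ∂ₗ g_{ij})`. -/
def christoffel (g : (Fin n → ℝ) → Matrix (Fin n) (Fin n) ℝ) (k i j : Fin n)
    (x : Fin n → ℝ) : ℝ :=
  (1 / 2 : ℝ) * ∑ l, (g x)⁻¹ k l *
    (pderiv i (fun y => g y j l) x + pderiv j (fun y => g y i l) x
      - pderiv l (fun y => g y i j) x)

/-- The component along the `l`-th coordinate field of `R(∂ᵢ, ∂ⱼ)∂ₖ`, where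
`R(X, Y)Z = ∇_X ∇_Y Z - ∇_Y ∇_X Z - ∇_[X,Y] Z` for the Levi-Civita connection of `g`. -/
def riemann (g : (Fin n → ℝ) → Matrix (Fin n) (Fin n) ℝ) (l i j k : Fin n)
    (x : Fin n → ℝ) : ℝ :=
  pderiv i (christoffel g l j k) x - pderiv j (christoffel g l i k) x
    + ∑ m, (christoffel g l i m x * christoffel g m j k x
        - christoffel g l j m x * christoffel g m i k x)

/-- The Ricci tensor: `Ric(∂ⱼ, ∂ₖ)` is the trace of `X ↦ R(X, ∂ⱼ)∂ₖ`
(positive on round spheres). -/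
def ricci (g : (Fin n → ℝ) → Matrix (Fin n) (Fin n) ℝ) (x : Fin n → ℝ) :
    Matrix (Fin n) (Fin n) ℝ :=
  Matrix.of fun j k => ∑ i, riemann g i i j k x

/-- `g t`, for `t ∈ [0, T]`, is a family of Riemannian metrics on `U`, smooth on `[0, T] × U`,
that solves the Ricci flow equation `∂ₜ g = -2 Ric(g)` (with one-sided time derivatives at the
ends of `[0, T]`). -/
structure IsRicciFlow (U : Set (Fin n → ℝ)) (T : ℝ)
    (g : ℝ → (Fin n → ℝ) → Matrix (Fin n) (Fin n) ℝ) : Prop where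
  smooth : ∀ i j, ContDiffOn ℝ ∞ (fun p : ℝ × (Fin n → ℝ) => g p.1 p.2 i j)
    (Set.Icc 0 T ×ˢ U)
  posDef : ∀ t ∈ Set.Icc 0 T, ∀ x ∈ U, (g t x).PosDef
  evolution : ∀ t ∈ Set.Icc 0 T, ∀ x ∈ U, ∀ i j,
    HasDerivWithinAt (fun s => g s x i j) (-2 * ricci (g t) x i j) (Set.Icc 0 T) t

end LocalGeometry

end

noncomputable section

namespace LocalGeometry

variable {n : ℕ}

/-! ### Partial derivatives -/

lemma pderiv_eq_of_hasFDerivAt {i : Fin n} {f : (Fin n → ℝ) → ℝ} {x : Fin n → ℝ}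
    {f' : (Fin n → ℝ) →L[ℝ] ℝ} (h : HasFDerivAt f f' x) :
    pderiv i f x = f' (Pi.single i 1) := by
  rw [pderiv, h.fderiv]

lemma pderiv_congr {i : Fin n} {f g : (Fin n → ℝ) → ℝ} {U : Set (Fin n → ℝ)} (hU : IsOpen U)
    (h : ∀ y ∈ U, f y = g y) {x : Fin n → ℝ} (hx : x ∈ U) : pderiv i f x = pderiv i g x := by
  rw [pderiv, pderiv,
    Filter.EventuallyEq.fderiv_eq (Filter.eventually_of_mem (hU.mem_nhds hx) h)]

/-- The Kronecker delta. -/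
def kdelta (i j : Fin n) : ℝ := if i = j then 1 else 0

lemma kdelta_comm (i j : Fin n) : kdelta i j = kdelta j i := by
  simp [kdelta, eq_comm]

lemma kdelta_self (i : Fin n) : kdelta i i = 1 := by simp [kdelta]

lemma sum_kdelta_mul (i : Fin n) (f : Fin n → ℝ) : ∑ l, kdelta i l * f l = f i := by
  simp [kdelta]

lemma single_eq_kdelta (i j : Fin n) : (Pi.single i (1 : ℝ) : Fin n → ℝ) j = kdelta i j := by
  simp [kdelta, Pi.single_apply, eq_comm]

/-- The square of the Euclidean norm. -/
def normSq (x : Fin n → ℝ) : ℝ := ∑ i, x i ^ 2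

lemma contDiff_normSq : ContDiff ℝ ∞ (normSq : (Fin n → ℝ) → ℝ) := by
  unfold normSq
  fun_prop

lemma differentiable_normSq : Differentiable ℝ (normSq : (Fin n → ℝ) → ℝ) :=
  contDiff_normSq.differentiable (by simp)

lemma pderiv_normSq (k : Fin n) (x : Fin n → ℝ) : pderiv k normSq x = 2 * x k := by
  have h : HasFDerivAt (normSq : (Fin n → ℝ) → ℝ)
      (∑ i, (2 * x i ^ (2 - 1)) • (ContinuousLinearMap.proj i : (Fin n → ℝ) →L[ℝ] ℝ)) x := by
    unfold normSq
    refine HasFDerivAt.fun_sum fun i _ => ?_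
    simpa using (hasFDerivAt_apply (𝕜 := ℝ) i x).pow 2
  rw [pderiv_eq_of_hasFDerivAt h]
  simp [Pi.single_apply]

lemma pderiv_coord (k i : Fin n) (x : Fin n → ℝ) : pderiv k (fun y => y i) x = kdelta k i := by
  rw [pderiv_eq_of_hasFDerivAt (hasFDerivAt_apply (𝕜 := ℝ) i x)]
  simp [single_eq_kdelta]

lemma pderiv_const (k : Fin n) (c : ℝ) (x : Fin n → ℝ) : pderiv k (fun _ => c) x = 0 := by
  simp [pderiv]

lemma pderiv_add (k : Fin n) {f g : (Fin n → ℝ) → ℝ} {x : Fin n → ℝ}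
    (hf : DifferentiableAt ℝ f x) (hg : DifferentiableAt ℝ g x) :
    pderiv k (fun y => f y + g y) x = pderiv k f x + pderiv k g x := by
  simp [pderiv, fderiv_fun_add hf hg]

lemma pderiv_sub (k : Fin n) {f g : (Fin n → ℝ) → ℝ} {x : Fin n → ℝ}
    (hf : DifferentiableAt ℝ f x) (hg : DifferentiableAt ℝ g x) :
    pderiv k (fun y => f y - g y) x = pderiv k f x - pderiv k g x := by
  simp [pderiv, fderiv_fun_sub hf hg]

lemma pderiv_mul (k : Fin n) {f g : (Fin n → ℝ) → ℝ} {x : Fin n → ℝ}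
    (hf : DifferentiableAt ℝ f x) (hg : DifferentiableAt ℝ g x) :
    pderiv k (fun y => f y * g y) x = pderiv k f x * g x + f x * pderiv k g x := by
  simp [pderiv, fderiv_fun_mul hf hg]
  ring

lemma pderiv_inv (k : Fin n) {f : (Fin n → ℝ) → ℝ} {x : Fin n → ℝ}
    (hf : DifferentiableAt ℝ f x) (h0 : f x ≠ 0) :
    pderiv k (fun y => (f y)⁻¹) x = -pderiv k f x / f x ^ 2 := by
  have h : HasFDerivAt (fun y => (f y)⁻¹) (-(f x ^ 2)⁻¹ • fderiv ℝ f x) x :=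
    (hasDerivAt_inv h0).comp_hasFDerivAt x hf.hasFDerivAt
  rw [pderiv_eq_of_hasFDerivAt h]
  simp only [pderiv, _root_.smul_apply, smul_eq_mul]
  ring

/-! ### Metrics on the cylinder over the round sphere, in Cartesian coordinates -/

/-- With `r = |x|` this is `a g_S + (a + b) dr² / r²`, where `g_S` is the round metric of the unit
sphere. -/
def cylinderMetric (a b : ℝ) (x : Fin n → ℝ) : Matrix (Fin n) (Fin n) ℝ :=
  Matrix.of fun i j =>
    a * kdelta i j * (normSq x)⁻¹ + b * (x i * x j) * ((normSq x)⁻¹ * (normSq x)⁻¹)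

lemma cylinderMetric_apply (a b : ℝ) (x : Fin n → ℝ) (i j : Fin n) :
    cylinderMetric a b x i j
      = a * kdelta i j * (normSq x)⁻¹ + b * (x i * x j) * ((normSq x)⁻¹ * (normSq x)⁻¹) := rfl

lemma cylinderMetric_inv {a b : ℝ} (ha : a ≠ 0) (hab : a + b ≠ 0) {x : Fin n → ℝ}
    (hx : normSq x ≠ 0) (k l : Fin n) :
    (cylinderMetric a b x)⁻¹ k l
      = normSq x / a * kdelta k l + (1 / (a + b) - 1 / a) * (x k * x l) := by
  have key : cylinderMetric a b x * (Matrix.of fun k l : Fin n =>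
      normSq x / a * kdelta k l + (1 / (a + b) - 1 / a) * (x k * x l)) = 1 := by
    ext i j
    have h : ∀ l, cylinderMetric a b x i l *
        (normSq x / a * kdelta l j + (1 / (a + b) - 1 / a) * (x l * x j))
        = kdelta i l * (a * (normSq x)⁻¹ * (normSq x / a * kdelta l j
            + (1 / (a + b) - 1 / a) * (x l * x j)))
          + kdelta j l * (b * (x i * x l) * ((normSq x)⁻¹ * (normSq x)⁻¹) * (normSq x / a))
          + (b * (x i * x j) * ((normSq x)⁻¹ * (normSq x)⁻¹) * (1 / (a + b) - 1 / a)) * x l ^ 2 := by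
      intro l
      rw [cylinderMetric_apply, kdelta_comm l j]
      ring
    simp only [Matrix.mul_apply, Matrix.of_apply, h, Finset.sum_add_distrib, sum_kdelta_mul,
      ← Finset.mul_sum]
    rw [← normSq, Matrix.one_apply, ← kdelta]
    field_simp
    ring
  rw [Matrix.inv_eq_right_inv key, Matrix.of_apply]

lemma pderiv_cylinderMetric (a b : ℝ) {x : Fin n → ℝ} (hx : normSq x ≠ 0) (k i j : Fin n) :
    pderiv k (fun y => cylinderMetric a b y i j) x
      = -2 * a * kdelta i j * x k / normSq x ^ 2
        + b * (kdelta k i * x j + kdelta k j * x i) / normSq x ^ 2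
        - 4 * b * x i * x j * x k / normSq x ^ 3 := by
  have hq := differentiable_normSq x
  have hqi : DifferentiableAt ℝ (fun y => (normSq y)⁻¹) x := hq.fun_inv hx
  simp only [cylinderMetric_apply]
  rw [pderiv_add _ (by fun_prop) (by fun_prop), pderiv_mul _ (by fun_prop) (by fun_prop),
    pderiv_mul _ (by fun_prop) (by fun_prop), pderiv_mul _ (by fun_prop) (by fun_prop),
    pderiv_mul _ (by fun_prop) (by fun_prop), pderiv_mul _ (by fun_prop) (by fun_prop),
    pderiv_mul _ (by fun_prop) (by fun_prop), pderiv_inv _ hq hx, pderiv_const, pderiv_const,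
    pderiv_const, pderiv_coord, pderiv_coord]
  rw [show pderiv k (fun y => normSq y) x = 2 * x k from pderiv_normSq k x]
  field_simp
  ring

lemma christoffel_cylinderMetric {a b : ℝ} (ha : a ≠ 0) (hab : a + b ≠ 0) {x : Fin n → ℝ}
    (hx : normSq x ≠ 0) (k i j : Fin n) :
    christoffel (cylinderMetric a b) k i j x
      = (kdelta i j * x k - kdelta j k * x i - kdelta i k * x j) * (normSq x)⁻¹ := by
  have h : ∀ l, (cylinderMetric a b x)⁻¹ k l *
      (pderiv i (fun y => cylinderMetric a b y j l) x
        + pderiv j (fun y => cylinderMetric a b y i l) x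
        - pderiv l (fun y => cylinderMetric a b y i j) x)
      = kdelta k l * (normSq x / a * ((-2 * a * (kdelta j l * x i + kdelta i l * x j)
            + 2 * (a + b) * kdelta i j * x l) / normSq x ^ 2
            - 4 * b * x i * x j * x l / normSq x ^ 3))
        + kdelta j l * ((1 / (a + b) - 1 / a) * (x k * x l) * (-2 * a * x i / normSq x ^ 2))
        + kdelta i l * ((1 / (a + b) - 1 / a) * (x k * x l) * (-2 * a * x j / normSq x ^ 2))
        + (1 / (a + b) - 1 / a) * x k * (2 * (a + b) * kdelta i j / normSq x ^ 2
            - 4 * b * x i * x j / normSq x ^ 3) * x l ^ 2 := by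
    intro l
    rw [cylinderMetric_inv ha hab hx, pderiv_cylinderMetric a b hx, pderiv_cylinderMetric a b hx,
      pderiv_cylinderMetric a b hx, kdelta_comm j i, kdelta_comm l i, kdelta_comm l j]
    ring
  simp only [christoffel, h, Finset.sum_add_distrib, sum_kdelta_mul, ← Finset.mul_sum]
  rw [← normSq]
  field_simp
  ring

lemma pderiv_christoffel_cylinderMetric {a b : ℝ} (ha : a ≠ 0) (hab : a + b ≠ 0) {x : Fin n → ℝ}
    (hx : normSq x ≠ 0) (p k i j : Fin n) :
    pderiv p (christoffel (cylinderMetric a b) k i j) x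
      = (kdelta i j * kdelta p k - kdelta j k * kdelta p i - kdelta i k * kdelta p j) / normSq x
        - 2 * x p * (kdelta i j * x k - kdelta j k * x i - kdelta i k * x j) / normSq x ^ 2 := by
  have hopen : IsOpen {y : Fin n → ℝ | normSq y ≠ 0} :=
    isOpen_ne_fun differentiable_normSq.continuous continuous_const
  rw [pderiv_congr hopen (fun y hy => christoffel_cylinderMetric ha hab hy k i j) hx]
  have hq := differentiable_normSq x
  have hqi : DifferentiableAt ℝ (fun y => (normSq y)⁻¹) x := hq.fun_inv hx
  rw [pderiv_mul _ (by fun_prop) (by fun_prop), pderiv_sub _ (by fun_prop) (by fun_prop),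
    pderiv_sub _ (by fun_prop) (by fun_prop), pderiv_mul _ (by fun_prop) (by fun_prop),
    pderiv_mul _ (by fun_prop) (by fun_prop), pderiv_mul _ (by fun_prop) (by fun_prop),
    pderiv_inv _ hq hx, pderiv_const, pderiv_const, pderiv_const, pderiv_coord, pderiv_coord,
    pderiv_coord]
  rw [show pderiv p (fun y => normSq y) x = 2 * x p from pderiv_normSq p x]
  field_simp
  ring

/-- The Ricci tensor of a cylinder metric is that of its spherical factor, whatever the scales. -/
lemma ricci_cylinderMetric {a b : ℝ} (ha : a ≠ 0) (hab : a + b ≠ 0) {x : Fin n → ℝ}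
    (hx : normSq x ≠ 0) (j k : Fin n) :
    ricci (cylinderMetric a b) x j k
      = ((n : ℝ) - 2) * (kdelta j k * (normSq x)⁻¹
          - x j * x k * ((normSq x)⁻¹ * (normSq x)⁻¹)) := by
  have hquad : ∀ i, ∑ m, (christoffel (cylinderMetric a b) i i m x
        * christoffel (cylinderMetric a b) m j k x
      - christoffel (cylinderMetric a b) i j m x * christoffel (cylinderMetric a b) m i k x)
      = (2 * (x j * x k) - kdelta j k * normSq x - (kdelta i k * (x i * x j)
          - kdelta j k * x i ^ 2 + kdelta i j * (x i * x k) + x j * x k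
          - kdelta i j * kdelta i k * normSq x)) / normSq x ^ 2 := by
    intro i
    have h : ∀ m, christoffel (cylinderMetric a b) i i m x
          * christoffel (cylinderMetric a b) m j k x
        - christoffel (cylinderMetric a b) i j m x * christoffel (cylinderMetric a b) m i k x
        = kdelta k m * (x m * x j * (normSq x)⁻¹ ^ 2)
          + kdelta j m * (x m * x k * (normSq x)⁻¹ ^ 2)
          - kdelta j m * (x i * (kdelta i k * x m - kdelta m k * x i - kdelta i m * x k)
              * (normSq x)⁻¹ ^ 2)
          + kdelta i m * (x j * (kdelta i k * x m - kdelta m k * x i - kdelta i m * x k)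
              * (normSq x)⁻¹ ^ 2)
          - kdelta k m * (kdelta i j * x m * x i * (normSq x)⁻¹ ^ 2)
          - kdelta i m * (kdelta i j * x m * x k * (normSq x)⁻¹ ^ 2)
          + (kdelta i j * kdelta i k - kdelta j k) * (normSq x)⁻¹ ^ 2 * x m ^ 2 := by
      intro m
      rw [christoffel_cylinderMetric ha hab hx, christoffel_cylinderMetric ha hab hx,
        christoffel_cylinderMetric ha hab hx, christoffel_cylinderMetric ha hab hx,
        kdelta_self, kdelta_comm m i, kdelta_comm m k, kdelta_comm j i]
      ring
    simp only [h, Finset.sum_add_distrib, Finset.sum_sub_distrib, sum_kdelta_mul,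
      ← Finset.mul_sum]
    rw [← normSq, kdelta_self]
    field_simp
    ring
  have h : ∀ i, riemann (cylinderMetric a b) i i j k x
      = (kdelta j k * (normSq x)⁻¹ - x j * x k * (normSq x ^ 2)⁻¹)
        - kdelta j i * (kdelta i k * (normSq x)⁻¹)
        + kdelta k i * (x i * x j * (normSq x)⁻¹ ^ 2)
        + kdelta j i * (x i * x k * (normSq x)⁻¹ ^ 2)
        - kdelta j k * (normSq x)⁻¹ ^ 2 * x i ^ 2 := by
    intro i
    rw [riemann, hquad, pderiv_christoffel_cylinderMetric ha hab hx,
      pderiv_christoffel_cylinderMetric ha hab hx, kdelta_self, kdelta_comm k i, kdelta_comm j i]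
    field_simp
    ring
  simp only [ricci, Matrix.of_apply, h, Finset.sum_add_distrib, Finset.sum_sub_distrib,
    sum_kdelta_mul, ← Finset.mul_sum]
  rw [← normSq, Finset.sum_const, Finset.sum_const, Finset.card_univ, Fintype.card_fin,
    nsmul_eq_mul, nsmul_eq_mul]
  field_simp
  ring

lemma contDiffOn_cylinderMetric {U : Set (Fin n → ℝ)} (hU : ∀ x ∈ U, normSq x ≠ 0) {s : Set ℝ}
    {a b : ℝ → ℝ} (ha : ContDiff ℝ ∞ a) (hb : ContDiff ℝ ∞ b) (i j : Fin n) :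
    ContDiffOn ℝ ∞ (fun p : ℝ × (Fin n → ℝ) => cylinderMetric (a p.1) (b p.1) p.2 i j)
      (s ×ˢ U) := by
  have hinv : ContDiffOn ℝ ∞ (fun p : ℝ × (Fin n → ℝ) => (normSq p.2)⁻¹) (s ×ˢ U) :=
    (contDiff_normSq.comp contDiff_snd).contDiffOn.inv fun p hp => hU p.2 hp.2
  have ha' : ContDiff ℝ ∞ (fun p : ℝ × (Fin n → ℝ) => a p.1) := ha.comp contDiff_fst
  have hb' : ContDiff ℝ ∞ (fun p : ℝ × (Fin n → ℝ) => b p.1) := hb.comp contDiff_fst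
  have hx : ∀ i, ContDiff ℝ ∞ (fun p : ℝ × (Fin n → ℝ) => p.2 i) := fun i =>
    (contDiff_apply ℝ ℝ i).comp contDiff_snd
  simp only [cylinderMetric_apply]
  exact ((ha'.mul contDiff_const).contDiffOn.mul hinv).add
    ((hb'.mul ((hx i).mul (hx j))).contDiffOn.mul (hinv.mul hinv))

lemma posDef_cylinderMetric {a b : ℝ} (ha : 0 < a) (hb : 0 ≤ b) {x : Fin n → ℝ}
    (hx : 0 < normSq x) : (cylinderMetric a b x).PosDef := by
  refine Matrix.PosDef.of_dotProduct_mulVec_pos ?_ fun v hv => ?_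
  · ext i j
    simp only [Matrix.conjTranspose_apply, cylinderMetric_apply, star_trivial, kdelta_comm j i]
    ring
  · have hv' : 0 < normSq v := by
      obtain ⟨i, hi⟩ := Function.ne_iff.mp hv
      exact Finset.sum_pos' (fun i _ => sq_nonneg _) ⟨i, Finset.mem_univ i, by
        have : v i ≠ 0 := hi
        positivity⟩
    have hmul : ∀ i, (cylinderMetric a b x).mulVec v i
        = a * (normSq x)⁻¹ * v i + b * ((normSq x)⁻¹ * (normSq x)⁻¹) * (∑ j, x j * v j) * x i := by
      intro i
      have h : ∀ j, cylinderMetric a b x i j * v j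
          = kdelta i j * (a * (normSq x)⁻¹ * v j)
            + b * ((normSq x)⁻¹ * (normSq x)⁻¹) * x i * (x j * v j) := by
        intro j
        rw [cylinderMetric_apply]
        ring
      simp only [Matrix.mulVec, dotProduct, h, Finset.sum_add_distrib, sum_kdelta_mul,
        ← Finset.mul_sum]
      ring
    have hquad : star v ⬝ᵥ (cylinderMetric a b x).mulVec v = a * (normSq x)⁻¹ * normSq v
        + b * ((normSq x)⁻¹ * (normSq x)⁻¹) * (∑ j, x j * v j) ^ 2 := by
      have h : ∀ i, v i * (a * (normSq x)⁻¹ * v i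
            + b * ((normSq x)⁻¹ * (normSq x)⁻¹) * (∑ j, x j * v j) * x i)
          = a * (normSq x)⁻¹ * v i ^ 2
            + b * ((normSq x)⁻¹ * (normSq x)⁻¹) * (∑ j, x j * v j) * (x i * v i) := by
        intro i
        ring
      simp only [dotProduct, hmul, star_trivial, h, Finset.sum_add_distrib, ← Finset.mul_sum]
      rw [← normSq]
      ring
    rw [hquad]
    positivity

/-- The shrinking cylinder: the round sphere factor shrinks at constant speed, the length along the
axis is constant. -/
lemma isRicciFlow_cylinderMetric (hn : 2 ≤ n) {T c : ℝ} (hc : 2 * ((n : ℝ) - 2) * T < c)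
    (hc0 : 0 < c) {U : Set (Fin n → ℝ)} (hU : ∀ x ∈ U, 0 < normSq x) :
    IsRicciFlow U T (fun t =>
      cylinderMetric (c - 2 * ((n : ℝ) - 2) * t) (2 * ((n : ℝ) - 2) * t)) := by
  have hn' : (0 : ℝ) ≤ (n : ℝ) - 2 := by
    have : (2 : ℝ) ≤ n := by exact_mod_cast hn
    linarith
  have hpos : ∀ t ∈ Set.Icc 0 T, 0 < c - 2 * ((n : ℝ) - 2) * t := fun t ht => by
    have : 2 * ((n : ℝ) - 2) * t ≤ 2 * ((n : ℝ) - 2) * T :=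
      mul_le_mul_of_nonneg_left ht.2 (by linarith)
    linarith
  refine ⟨fun i j => contDiffOn_cylinderMetric (a := fun t => c - 2 * ((n : ℝ) - 2) * t)
    (b := fun t => 2 * ((n : ℝ) - 2) * t) (fun x hx => (hU x hx).ne') (by fun_prop)
    (by fun_prop) i j, fun t ht x hx => posDef_cylinderMetric (hpos t ht)
      (mul_nonneg (by linarith) ht.1) (hU x hx), fun t ht x hx i j => ?_⟩
  rw [ricci_cylinderMetric (hpos t ht).ne' (by simpa using hc0.ne') (hU x hx).ne']
  simp only [cylinderMetric_apply]
  have hlin : HasDerivAt (fun s : ℝ => 2 * ((n : ℝ) - 2) * s) (2 * ((n : ℝ) - 2)) t := by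
    simpa using (hasDerivAt_id t).const_mul (2 * ((n : ℝ) - 2))
  refine HasDerivAt.hasDerivWithinAt ?_
  refine ((((hlin.const_sub c).mul_const (kdelta i j)).mul_const (normSq x)⁻¹).fun_add
    ((hlin.mul_const (x i * x j)).mul_const ((normSq x)⁻¹ * (normSq x)⁻¹))).congr_deriv ?_
  ring

/-- A component of a Ricci flow that vanishes at a point for all times has vanishing Ricci component
there. -/
lemma IsRicciFlow.ricci_eq_zero {U : Set (Fin n → ℝ)} {T : ℝ}
    {g : ℝ → (Fin n → ℝ) → Matrix (Fin n) (Fin n) ℝ} (hg : IsRicciFlow U T g) (hT : 0 < T)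
    {x : Fin n → ℝ} (hx : x ∈ U) {i j : Fin n} (h : ∀ s ∈ Set.Icc 0 T, g s x i j = 0) {t : ℝ}
    (ht : t ∈ Set.Icc 0 T) : ricci (g t) x i j = 0 := by
  have h1 := hg.evolution t ht x hx i j
  have h2 : HasDerivWithinAt (fun s => g s x i j) 0 (Set.Icc 0 T) t :=
    (hasDerivWithinAt_const t (Set.Icc 0 T) (0 : ℝ)).congr h (h t ht)
  have := (uniqueDiffOn_Icc hT t ht).eq_deriv _ h1 h2
  linarith

end LocalGeometry

end

theorem theorem1 (n : ℕ) (T : ℝ) (hT : 0 < T) :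
    (3 ≤ n →
      ∃ (U : Set (Fin n → ℝ)) (g : ℝ → (Fin n → ℝ) → Matrix (Fin n) (Fin n) ℝ),
        IsOpen U ∧ IsConnected U ∧ LocalGeometry.IsRicciFlow U T g ∧
        (∀ x ∈ U, (g 0 x).IsDiag) ∧
        ∀ i j : Fin n, i ≠ j →
          (∃ t ∈ Set.Ioc 0 T, ∃ x ∈ U, LocalGeometry.ricci (g t) x i j ≠ 0) ∧
          (∃ t ∈ Set.Ioc 0 T, ∃ x ∈ U, g t x i j ≠ 0)) ∧
    (∀ (U : Set (Fin n → ℝ)) (g : ℝ → (Fin n → ℝ) → Matrix (Fin n) (Fin n) ℝ),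
        IsOpen U → LocalGeometry.IsRicciFlow U T g →
        (∀ x ∈ U, (g 0 x).IsDiag) →
        ∀ i j : Fin n, i ≠ j → ∀ x ∈ U,
          (∃ t ∈ Set.Icc 0 T, LocalGeometry.ricci (g t) x i j ≠ 0) →
          ∃ s ∈ Set.Ioc 0 T, g s x i j ≠ 0) := by
  refine ⟨fun hn => ?_, fun U g _ hg hdiag i j hij x hx ⟨t, ht, hric⟩ => ?_⟩
  · have hn' : (0 : ℝ) < (n : ℝ) - 2 := by
      have : (3 : ℝ) ≤ n := by exact_mod_cast hn
      linarith
    have hc : 0 < 2 * ((n : ℝ) - 2) * T := by positivity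
    have hU : ∀ x ∈ Set.univ.pi fun _ : Fin n => Set.Ioi (0 : ℝ), 0 < LocalGeometry.normSq x :=
      fun x hx => Finset.sum_pos (fun i _ => pow_pos (hx i trivial) 2)
        ⟨⟨0, by omega⟩, Finset.mem_univ _⟩
    have h1 : (fun _ => 1 : Fin n → ℝ) ∈ Set.univ.pi fun _ : Fin n => Set.Ioi (0 : ℝ) :=
      fun i _ => one_pos (α := ℝ)
    have hq := hU _ h1
    refine ⟨Set.univ.pi fun _ => Set.Ioi 0, _, isOpen_set_pi Set.finite_univ fun _ _ => isOpen_Ioi,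
      ⟨⟨_, h1⟩, (convex_pi fun _ _ => convex_Ioi 0).isPreconnected⟩,
      LocalGeometry.isRicciFlow_cylinderMetric (by omega) (lt_add_one _) (by positivity) hU,
      fun x _ i j hij => ?_, fun i j hij => ⟨⟨T, ⟨hT, le_rfl⟩, _, h1, ?_⟩,
        ⟨T, ⟨hT, le_rfl⟩, _, h1, ?_⟩⟩⟩
    · simp [LocalGeometry.cylinderMetric_apply, LocalGeometry.kdelta, hij]
    · rw [LocalGeometry.ricci_cylinderMetric (by simp) (by simpa using (by positivity)) hq.ne']
      simp [LocalGeometry.kdelta, hij, hn'.ne', hq.ne']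
    · simp [LocalGeometry.cylinderMetric_apply, LocalGeometry.kdelta, hij, hn'.ne', hq.ne', hT.ne']
  · by_contra! hzero
    refine hric (hg.ricci_eq_zero hT hx (fun s hs => ?_) ht)
    rcases hs.1.eq_or_lt with rfl | hs0
    · exact hdiag x hx hij
    · exact hzero s ⟨hs0, hs.2⟩
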